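/- A partially ordered monoid is a (not necessarily commutative) monoid $K$ with a partial order such that $x\le y$ implies $xz\le yz$ and $zx\le zy$ for all $x,y,z\in K$. A Kuratowski monoid is a partially ordered monoid $K$ that is generated by a finite subset $L\subseteq K$ which is linearly ordered by the order of $K$, contains the unit $1$ of $K$, and consists of idempotents. A polytopological space is a set $X$ with a family $\mathcal T$ of topologies on $X$ that is linearly ordered by inclusion; its Kuratowski monoid is the submonoid, generated by the interior operators $\breve\tau$ and the closure operators $\bar\tau$ for $\tau\in\mathcal T$, of the monoid of all maps $\mathcal P(X)\to\mathcal P(X)$ under composition. **Proposition.** Every element $x$ of any Kuratowski monoid $K$ is idempotent, that is, $x\cdot x=x$. In particular, for every polytopological space $(X,\mathcal T)$, every element $f$ of its Kuratowski monoid satisfies $f\circ f=f$. -/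

import Mathlib

/-- A linear generating set of a partially ordered monoid `K`: a finite set, linearly ordered by
the order of `K`, containing the unit, consisting of idempotents, and generating `K`. -/
structure IsLinearGeneratingSet {K : Type*} [Monoid K] [PartialOrder K] (L : Set K) : Prop where
  finite : L.Finite
  linear : IsChain (· ≤ ·) L
  one_mem : (1 : K) ∈ L
  idempotent : ∀ x ∈ L, IsIdempotentElem x
  generates : Submonoid.closure L = ⊤

/-- A Kuratowski monoid: a partially ordered monoid (the multiplication is monotone in each
variable; `K` need not be commutative) that has a linear generating set. -/
def IsKuratowskiMonoid (K : Type*) [Monoid K] [PartialOrder K] [MulLeftMono K] [MulRightMono K] :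
    Prop :=
  ∃ L : Set K, IsLinearGeneratingSet L

/-- A family of topologies on `X` is a polytopology if it is linearly ordered by inclusion of the
families of open sets. -/
def IsPolytopology {X : Type*} (T : Set (TopologicalSpace X)) : Prop :=
  IsChain (fun t s : TopologicalSpace X => {U : Set X | t.IsOpen U} ⊆ {U : Set X | s.IsOpen U}) T

/-- The operator of interior with respect to a topology, as an element of the monoid of all
self-maps of the power set (under composition). -/
def interiorOperator {X : Type*} (t : TopologicalSpace X) : Function.End (Set X) :=
  fun A => @interior X t A

/-- The operator of closure with respect to a topology, as an element of the monoid of all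
self-maps of the power set (under composition). -/
def closureOperator {X : Type*} (t : TopologicalSpace X) : Function.End (Set X) :=
  fun A => @closure X t A

/-- The Kuratowski monoid of the set `X` with the family `T` of topologies: the submonoid generated
by the interior and closure operators of all topologies in `T`. -/
def kuratowskiMonoid {X : Type*} (T : Set (TopologicalSpace X)) :
    Submonoid (Function.End (Set X)) :=
  Submonoid.closure (interiorOperator '' T ∪ closureOperator '' T)

/-! Any word in the generators can be written around its extreme letters: the largest `p` and the
smallest `n`, with `n ≤ 1 ≤ p`. Squeezing gives `p * z * n = p * n` and `n * z * p = n * p` for `z ∈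
[n, p]`. Hence in `w * w` everything between the two copies of the core `p * n` or `n * p` is
absorbed. Monotone operators form an ordered monoid, so the topological case follows. -/

section OrderedMonoid

variable {K : Type*} [Monoid K] [PartialOrder K] [MulLeftMono K] [MulRightMono K]

/-- `w` factors through a product of two opposite idempotents `n ≤ 1 ≤ p`, all other factors lying
between `n` and `p`. -/
def HasPeak (L : Set K) (w : K) : Prop :=
  ∃ p ∈ L, ∃ n ∈ L, n ≤ 1 ∧ 1 ≤ p ∧ ∃ u ∈ Set.Icc n p, ∃ v ∈ Set.Icc n p,
    w = u * (p * n) * v ∨ w = u * (n * p) * v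

theorem IsIdempotentElem.mul_mem_Icc {n p x y : K} (hn : IsIdempotentElem n)
    (hp : IsIdempotentElem p) (hx : x ∈ Set.Icc n p) (hy : y ∈ Set.Icc n p) :
    x * y ∈ Set.Icc n p :=
  ⟨hn.eq.symm.le.trans (mul_le_mul' hx.1 hy.1), (mul_le_mul' hx.2 hy.2).trans hp.eq.le⟩

/-- If `x` is idempotent and above `z ≥ n`, the factor `z` in `x * z * n` is absorbed. -/
theorem mul_mul_eq_of_mem_Icc_left {x n z : K} (hx : IsIdempotentElem x)
    (hn : IsIdempotentElem n) (hz : z ∈ Set.Icc n x) : x * z * n = x * n := by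
  apply le_antisymm
  · calc x * z * n ≤ x * x * n := by gcongr; exact hz.2
      _ = x * n := by rw [hx.eq]
  · calc x * n = x * n * n := by rw [mul_assoc, hn.eq]
      _ ≤ x * z * n := by gcongr; exact hz.1

/-- If `x` is idempotent and below `z ≤ p`, the factor `z` in `x * z * p` is absorbed. -/
theorem mul_mul_eq_of_mem_Icc_right {x p z : K} (hx : IsIdempotentElem x)
    (hp : IsIdempotentElem p) (hz : z ∈ Set.Icc x p) : x * z * p = x * p := by
  apply le_antisymm
  · calc x * z * p ≤ x * p * p := by gcongr; exact hz.2
      _ = x * p := by rw [mul_assoc, hp.eq]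
  · calc x * p = x * x * p := by rw [hx.eq]
      _ ≤ x * z * p := by gcongr; exact hz.1

theorem HasPeak.isIdempotentElem {L : Set K} (hL : ∀ x ∈ L, IsIdempotentElem x) {w : K}
    (hw : HasPeak L w) : IsIdempotentElem w := by
  obtain ⟨p, hpL, n, hnL, hn1, h1p, u, hu, v, hv, h⟩ := hw
  have hp := hL p hpL
  have hn := hL n hnL
  have hnp : n ≤ p := hn1.trans h1p
  have hN : n ∈ Set.Icc n p := ⟨le_rfl, hnp⟩
  have hP : p ∈ Set.Icc n p := ⟨hnp, le_rfl⟩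
  have hz := hn.mul_mem_Icc hp hv hu
  rcases h with rfl | rfl
  · have key := mul_mul_eq_of_mem_Icc_left hp hn
      (hn.mul_mem_Icc hp (hn.mul_mem_Icc hp hN hz) hP)
    calc u * (p * n) * v * (u * (p * n) * v)
        = u * (p * (n * (v * u) * p) * n) * v := by simp only [mul_assoc]
      _ = u * (p * n) * v := by rw [key]
  · have key := mul_mul_eq_of_mem_Icc_right hn hp
      (hn.mul_mem_Icc hp (hn.mul_mem_Icc hp hP hz) hN)
    calc u * (n * p) * v * (u * (n * p) * v)
        = u * (n * (p * (v * u) * n) * p) * v := by simp only [mul_assoc]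
      _ = u * (n * p) * v := by rw [key]

/-- A letter inside `[n, p]` joins `u`. A letter outside replaces the extreme it passes, and
absorption deletes what separates it from the opposite extreme. -/
theorem HasPeak.mul_left {L : Set K} (hc : IsChain (· ≤ ·) L)
    (hL : ∀ x ∈ L, IsIdempotentElem x) {x w : K} (hxL : x ∈ L) (hw : HasPeak L w) :
    HasPeak L (x * w) := by
  obtain ⟨p, hpL, n, hnL, hn1, h1p, u, hu, v, hv, h⟩ := hw
  have hp := hL p hpL
  have hn := hL n hnL
  have hx := hL x hxL
  have hnp : n ≤ p := hn1.trans h1p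
  have hN : n ∈ Set.Icc n p := ⟨le_rfl, hnp⟩
  have hP : p ∈ Set.Icc n p := ⟨hnp, le_rfl⟩
  rcases hc.total hpL hxL with hpx | hxp
  · have hI : Set.Icc n p ⊆ Set.Icc n x := Set.Icc_subset_Icc_right hpx
    have h1x := h1p.trans hpx
    refine ⟨x, hxL, n, hnL, hn1, h1x, 1, ⟨hn1, h1x⟩, ?_⟩
    rcases h with rfl | rfl
    · refine ⟨v, hI hv, Or.inl ?_⟩
      rw [one_mul, ← mul_mul_eq_of_mem_Icc_left hx hn (hI (hn.mul_mem_Icc hp hu hP))]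
      simp only [mul_assoc]
    -- Here `n` precedes `p`, so the new core is `x * n` and the old `p` moves into the right
    -- factor.
    · refine ⟨p * v, hI (hn.mul_mem_Icc hp hP hv), Or.inl ?_⟩
      rw [one_mul, ← mul_mul_eq_of_mem_Icc_left hx hn (hI hu)]
      simp only [mul_assoc]
  rcases hc.total hxL hnL with hxn | hnx
  · have hI : Set.Icc n p ⊆ Set.Icc x p := Set.Icc_subset_Icc_left hxn
    have hx1 := hxn.trans hn1
    refine ⟨p, hpL, x, hxL, hx1, h1p, 1, ⟨hx1, h1p⟩, ?_⟩
    rcases h with rfl | rfl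
    · refine ⟨n * v, hI (hn.mul_mem_Icc hp hN hv), Or.inr ?_⟩
      rw [one_mul, ← mul_mul_eq_of_mem_Icc_right hx hp (hI hu)]
      simp only [mul_assoc]
    · refine ⟨v, hI hv, Or.inr ?_⟩
      rw [one_mul, ← mul_mul_eq_of_mem_Icc_right hx hp (hI (hn.mul_mem_Icc hp hu hN))]
      simp only [mul_assoc]
  · refine ⟨p, hpL, n, hnL, hn1, h1p, x * u, hn.mul_mem_Icc hp ⟨hnx, hxp⟩ hu, v, hv, ?_⟩
    rcases h with rfl | rfl
    · exact Or.inl (by simp only [mul_assoc])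
    · exact Or.inr (by simp only [mul_assoc])

/-- In a partially ordered monoid, a chain of idempotents containing the unit generates a
submonoid of idempotents. -/
theorem isIdempotentElem_of_mem_closure_of_isChain {L : Set K} (hc : IsChain (· ≤ ·) L)
    (h1 : (1 : K) ∈ L) (hL : ∀ x ∈ L, IsIdempotentElem x) {w : K}
    (hw : w ∈ Submonoid.closure L) : IsIdempotentElem w := by
  refine HasPeak.isIdempotentElem hL ?_
  induction hw using Submonoid.closure_induction_left with
  | one => exact ⟨1, h1, 1, h1, le_rfl, le_rfl, 1, ⟨le_rfl, le_rfl⟩, 1, ⟨le_rfl, le_rfl⟩, by simp⟩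
  | mul_left x hx y _ ih => exact ih.mul_left hc hL hx

end OrderedMonoid

section Polytopology

variable {X : Type*}

/-- Left multiplication preserves the pointwise order only for monotone maps; hence the passage from
`Function.End` to `→o`. -/
instance OrderHom.instMulLeftMono {α : Type*} [Preorder α] : MulLeftMono (α →o α) :=
  ⟨fun f _ _ h a => f.monotone (h a)⟩

instance OrderHom.instMulRightMono {α : Type*} [Preorder α] : MulRightMono (α →o α) :=
  ⟨fun f _ _ h a => h (f a)⟩

/-- Forgetting monotonicity, as a monoid homomorphism. -/
def OrderHom.toEndHom (α : Type*) [Preorder α] : (α →o α) →* Function.End α where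
  toFun f := f.toFun
  map_one' := rfl
  map_mul' _ _ := rfl

/-- The interior operator as a monotone map. -/
def interiorOrderHom (t : TopologicalSpace X) : Set X →o Set X :=
  ⟨interiorOperator t, fun _ _ h => @interior_mono X t _ _ h⟩

/-- The closure operator as a monotone map. -/
def closureOrderHom (t : TopologicalSpace X) : Set X →o Set X :=
  ⟨closureOperator t, fun _ _ h => @closure_mono X t _ _ h⟩

theorem interiorOrderHom_le_one (t : TopologicalSpace X) : interiorOrderHom t ≤ 1 :=
  fun _ => @interior_subset X t _

theorem one_le_closureOrderHom (t : TopologicalSpace X) : 1 ≤ closureOrderHom t :=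
  fun _ => @subset_closure X t _

theorem isIdempotentElem_interiorOrderHom (t : TopologicalSpace X) :
    IsIdempotentElem (interiorOrderHom t) :=
  OrderHom.ext _ _ (funext fun _ => @interior_interior X t _)

theorem isIdempotentElem_closureOrderHom (t : TopologicalSpace X) :
    IsIdempotentElem (closureOrderHom t) :=
  OrderHom.ext _ _ (funext fun _ => @closure_closure X t _)

theorem interiorOrderHom_le_of_le {s t : TopologicalSpace X} (h : s ≤ t) :
    interiorOrderHom t ≤ interiorOrderHom s := fun A =>
  @interior_maximal X s A _ (@interior_subset X t A) (h _ (@isOpen_interior X t A))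

theorem closureOrderHom_le_of_le {s t : TopologicalSpace X} (h : s ≤ t) :
    closureOrderHom s ≤ closureOrderHom t := fun _ => closure.mono h

theorem IsPolytopology.le_total {T : Set (TopologicalSpace X)} (hT : IsPolytopology T)
    {s t : TopologicalSpace X} (hs : s ∈ T) (ht : t ∈ T) : s ≤ t ∨ t ≤ s := by
  rcases eq_or_ne s t with rfl | hst
  · exact Or.inl le_rfl
  -- `s ≤ t` means that `t`-open sets are `s`-open, the reverse of inclusion, hence `symm`.
  · exact (hT hs ht hst).symm.imp (fun h U hU => h hU) (fun h U hU => h hU)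

theorem IsPolytopology.isChain_orderHom {T : Set (TopologicalSpace X)} (hT : IsPolytopology T) :
    IsChain (· ≤ ·) (insert 1 (interiorOrderHom '' T ∪ closureOrderHom '' T)) := by
  refine IsChain.insert ?_ ?_
  · rintro _ (⟨s, hs, rfl⟩ | ⟨s, hs, rfl⟩) _ (⟨t, ht, rfl⟩ | ⟨t, ht, rfl⟩) _
    · exact (hT.le_total hs ht).symm.imp interiorOrderHom_le_of_le interiorOrderHom_le_of_le
    · exact Or.inl ((interiorOrderHom_le_one s).trans (one_le_closureOrderHom t))
    · exact Or.inr ((interiorOrderHom_le_one t).trans (one_le_closureOrderHom s))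
    · exact (hT.le_total hs ht).imp closureOrderHom_le_of_le closureOrderHom_le_of_le
  · rintro _ (⟨s, hs, rfl⟩ | ⟨s, hs, rfl⟩) _
    · exact Or.inr (interiorOrderHom_le_one s)
    · exact Or.inl (one_le_closureOrderHom s)

theorem kuratowskiMonoid_le_map (T : Set (TopologicalSpace X)) :
    kuratowskiMonoid T ≤ (Submonoid.closure
      (insert 1 (interiorOrderHom '' T ∪ closureOrderHom '' T))).map
        (OrderHom.toEndHom (Set X)) := by
  refine Submonoid.closure_le.2 ?_
  rintro _ (⟨t, ht, rfl⟩ | ⟨t, ht, rfl⟩)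
  · exact ⟨interiorOrderHom t,
      Submonoid.subset_closure (Or.inr (Or.inl ⟨t, ht, rfl⟩)), rfl⟩
  · exact ⟨closureOrderHom t,
      Submonoid.subset_closure (Or.inr (Or.inr ⟨t, ht, rfl⟩)), rfl⟩

end Polytopology

theorem mainTheorem10 :
    (∀ (K : Type*) [Monoid K] [PartialOrder K] [MulLeftMono K] [MulRightMono K],
      IsKuratowskiMonoid K → ∀ x : K, IsIdempotentElem x) ∧
    (∀ (X : Type*) (T : Set (TopologicalSpace X)), IsPolytopology T →
      ∀ f ∈ kuratowskiMonoid T, IsIdempotentElem f) := by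
  refine ⟨fun K _ _ _ _ ⟨L, hL⟩ x => ?_, fun X T hT f hf => ?_⟩
  · exact isIdempotentElem_of_mem_closure_of_isChain hL.linear hL.one_mem hL.idempotent
      (hL.generates ▸ Submonoid.mem_top x)
  -- `T` may be infinite, so the chain version is applied to a monotone lift `g` of `f`.
  · obtain ⟨g, hg, rfl⟩ := kuratowskiMonoid_le_map T hf
    refine (isIdempotentElem_of_mem_closure_of_isChain hT.isChain_orderHom (Set.mem_insert _ _)
      ?_ hg).map _
    rintro _ (rfl | ⟨t, -, rfl⟩ | ⟨t, -, rfl⟩)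
    · exact IsIdempotentElem.one
    · exact isIdempotentElem_interiorOrderHom t
    · exact isIdempotentElem_closureOrderHom t
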